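/- Let $\mathbf{2Hilb}$ be the 2-category whose objects are the 2-Hilbert spaces $\mathbf{Hilb}^n$ ($n\in\mathbb N$), whose 1-cells $A\to B$ are matrices of finite-dimensional complex Hilbert spaces (composed by matrix multiplication using $\otimes$ and $\oplus$; composites of 1-cells are written from left to right), and whose 2-cells are matrices of linear maps, with $\dagger$ the entrywise adjoint. Write $I=\mathbf{Hilb}^1$. A *witness* of an object $A$ consists of 1-cells $L:I\to A$, $R:A\to I$ and 2-cells $\mathrm{create}:\mathrm{id}_I\Rightarrow LR$, $\mathrm{copy}:\mathrm{id}_A\Rightarrow RL$, $\mathrm{delete}=\mathrm{create}^\dagger$, $\mathrm{compare}=\mathrm{copy}^\dagger$, such that create/compare and copy/delete are the units/counits of adjunctions between $L$ and $R$ (all four zig-zag equations hold), $\mathrm{compare}\cdot\mathrm{copy}=\mathrm{id}$, and the multiplication $LRLR\Rightarrow LR$ induced by $\mathrm{compare}$ is commutative. Let $(L,R)$ be a witness of $A$, let $Q$ be a finite-dimensional Hilbert space, regarded as a 1-cell $I\to I$, and let $M: QQ\Rightarrow LR$ be a bipartite measurement vertex, i.e. a unitary 2-cell. A 2-cell $f: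 HJ\Rightarrow FG$, with $H:a\to r$, $J:r\to b$, $F:a\to g$, $G:g\to b$, is *horizontally invertible* if there are 1-cells $F',J',G',H'$ adjoint to $F,J,G,H$ (with cups $\mathrm{id}\Rightarrow FF'$, $JJ'$, $G'G$, $H'H$ as units and caps $F'F$, $J'J$, $GG'$, $HH'\Rightarrow\mathrm{id}$ as counits) and a 2-cell $f':J'H'\Rightarrow G'F'$ such that placing $f'$ to the right of $f$ and joining $J,J'$ by the cup and $G,G'$ by the cap gives $HH'\Rightarrow \mathrm{id}_a\Rightarrow FF'$ (cap followed by cup), and placing $f'$ to the left of $f$ and joining $H',H$ by the cup and $F',F$ by the cap gives $J'J\Rightarrow\mathrm{id}_b\Rightarrow G'G$ (cap followed by cup). $M$ *forms part of a solution to the teleportation specification with general shared resource* if there are a 2-cell $\psi:\mathrm{id}_I\Rightarrow QQ$ (an arbitrary bipartite vector, not necessarily a Bell state), a controlled operation $U:RQ\Rightarrow RQ$ (for instance a unitary one) and a scalar $c\neq 0$ (a normalisation) such that $$(\mathrm{id}_L\circ U)\cdot(M\circ \mathrm{id}_Q)\cdot(\mathrm{id}_Q\circ\psi)\;=\;c\,(\mathrm{create}\circ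 \mathrm{id}_Q)\;:\;Q\Rightarrow LRQ ,$$ where $\circ$ is horizontal and $\cdot$ is vertical composition, and coherence isomorphisms are suppressed. **Theorem.** If $M$ is not horizontally invertible, then $M$ does not form part of any solution to the teleportation specification, for any shared resource $\psi$. -/

import Mathlib

open CategoryTheory Bicategory
open scoped TensorProduct

/-- A finite-dimensional complex Hilbert space. -/
structure FdHilb where
  carrier : Type
  [normed : NormedAddCommGroup carrier]
  [inner : InnerProductSpace ℂ carrier]
  [finDim : FiniteDimensional ℂ carrier]

namespace FdHilb

instance : CoeSort FdHilb Type := ⟨FdHilb.carrier⟩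

attribute [instance] FdHilb.normed FdHilb.inner FdHilb.finDim

/-- Tensor product of Hilbert spaces. -/
noncomputable def tensor (X Y : FdHilb) : FdHilb := ⟨X ⊗[ℂ] Y⟩

/-- Orthogonal direct sum of a finite family of Hilbert spaces. -/
noncomputable def oplus {ι : Type} [Fintype ι] (X : ι → FdHilb) : FdHilb :=
  ⟨PiLp 2 (fun j => X j)⟩

/-- The Hilbert space `ℂ` if `p` holds and the zero space otherwise,
realised as the functions on the proofs of `p`. -/
noncomputable def delta (p : Prop) [Decidable p] : FdHilb := ⟨EuclideanSpace ℂ (PLift p)⟩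

variable {ι : Type} [Fintype ι] [DecidableEq ι] {X Y Z : ι → FdHilb}
variable {M : Type} [AddCommGroup M] [Module ℂ M]

/-- The pure tensor `x ⊗ y`. -/
noncomputable def tmul {A B : FdHilb} (x : A) (y : B) : tensor A B := x ⊗ₜ[ℂ] y

/-- A direct sum is, as a vector space, the product of its summands. -/
noncomputable def oplusEquiv (X : ι → FdHilb) : oplus X ≃ₗ[ℂ] (∀ j, X j) :=
  WithLp.linearEquiv 2 ℂ (∀ j, X j)

/-- The coordinates of a vector of `delta p`. -/
noncomputable def deltaEquiv (p : Prop) [Decidable p] : delta p ≃ₗ[ℂ] (PLift p → ℂ) :=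
  WithLp.linearEquiv 2 ℂ (PLift p → ℂ)

/-- The `j`-th inclusion into a direct sum. -/
noncomputable def inc (X : ι → FdHilb) (j : ι) : X j →ₗ[ℂ] oplus X :=
  (oplusEquiv X).symm.toLinearMap ∘ₗ LinearMap.single ℂ (fun j => X j) j

/-- The linear map out of a direct sum with given components. -/
noncomputable def desc (f : ∀ j, X j →ₗ[ℂ] M) : oplus X →ₗ[ℂ] M :=
  LinearMap.lsum ℂ (fun j => X j) ℂ f ∘ₗ (oplusEquiv X).toLinearMap

/-- The linear map out of a tensor product induced by a bilinear map. -/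
noncomputable def tlift {A B : FdHilb} (f : A →ₗ[ℂ] B →ₗ[ℂ] M) : tensor A B →ₗ[ℂ] M :=
  TensorProduct.lift f

/-- The bilinear map induced by a linear map out of a tensor product. -/
noncomputable def tcurry {A B : FdHilb} (f : tensor A B →ₗ[ℂ] M) : A →ₗ[ℂ] B →ₗ[ℂ] M :=
  TensorProduct.curry f

/-- Tensor product of linear maps. -/
noncomputable def tmap {A B C D : FdHilb} (f : A →ₗ[ℂ] C) (g : B →ₗ[ℂ] D) :
    tensor A B →ₗ[ℂ] tensor C D :=
  TensorProduct.map f g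

/-- The associativity isomorphism of the tensor product. -/
noncomputable def tassoc (A B C : FdHilb) :
    tensor (tensor A B) C ≃ₗ[ℂ] tensor A (tensor B C) :=
  TensorProduct.assoc ℂ A B C

/-- The vector `1` of `ℂ`. -/
noncomputable def one {p : Prop} [Decidable p] (_h : p) : delta p :=
  (deltaEquiv p).symm fun _ => 1

/-- The coordinate of a vector of `ℂ`. -/
noncomputable def coord {p : Prop} [Decidable p] (h : p) : delta p →ₗ[ℂ] ℂ :=
  (LinearMap.proj (PLift.up h)) ∘ₗ (deltaEquiv p).toLinearMap

@[simp] theorem desc_inc (f : ∀ j, X j →ₗ[ℂ] M) (j : ι) (x : X j) :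
    desc f (inc X j x) = f j x := by
  simp only [desc, inc, LinearMap.comp_apply, LinearEquiv.coe_coe, LinearEquiv.apply_symm_apply]
  exact LinearMap.lsum_piSingle ..

@[simp] theorem tlift_tmul {A B : FdHilb} (f : A →ₗ[ℂ] B →ₗ[ℂ] M) (x : A) (y : B) :
    tlift f (tmul x y) = f x y := TensorProduct.lift.tmul _ _

@[simp] theorem tcurry_apply {A B : FdHilb} (f : tensor A B →ₗ[ℂ] M) (x : A) (y : B) :
    tcurry f x y = f (tmul x y) := rfl

@[simp] theorem tmap_tmul {A B C D : FdHilb} (f : A →ₗ[ℂ] C) (g : B →ₗ[ℂ] D) (x : A) (y : B) :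
    tmap f g (tmul x y) = tmul (f x) (g y) := rfl

@[simp] theorem tassoc_tmul {A B C : FdHilb} (x : A) (y : B) (z : C) :
    tassoc A B C (tmul (tmul x y) z) = tmul x (tmul y z) := rfl

@[simp] theorem tassoc_symm_tmul {A B C : FdHilb} (x : A) (y : B) (z : C) :
    (tassoc A B C).symm (tmul x (tmul y z)) = tmul (tmul x y) z := rfl

@[simp] theorem coord_one {p : Prop} [Decidable p] (h : p) : coord h (one h) = 1 := by
  simp [coord, one]

theorem tmul_add {A B : FdHilb} (x : A) (y z : B) : tmul x (y + z) = tmul x y + tmul x z :=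
  TensorProduct.tmul_add _ _ _

theorem add_tmul {A B : FdHilb} (x y : A) (z : B) : tmul (x + y) z = tmul x z + tmul y z :=
  TensorProduct.add_tmul _ _ _

theorem tmul_zero {A B : FdHilb} (x : A) : tmul x (0 : B) = 0 := TensorProduct.tmul_zero _ _

theorem zero_tmul {A B : FdHilb} (y : B) : tmul (0 : A) y = 0 := TensorProduct.zero_tmul _ _

theorem tmul_smul {A B : FdHilb} (c : ℂ) (x : A) (y : B) : tmul x (c • y) = c • tmul x y :=
  TensorProduct.tmul_smul _ _ _

theorem smul_tmul {A B : FdHilb} (c : ℂ) (x : A) (y : B) : tmul (c • x) y = c • tmul x y :=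
  (TensorProduct.smul_tmul' _ _ _).symm

/-- A direct sum of tensor products is spanned by the pure tensors in the summands. -/
theorem oplus_induction {p : oplus (fun j => tensor (X j) (Y j)) → Prop} (h0 : p 0)
    (hadd : ∀ x y, p x → p y → p (x + y))
    (h : ∀ j (x : X j) (y : Y j), p (inc (fun j => tensor (X j) (Y j)) j (tmul x y)))
    (z : oplus (fun j => tensor (X j) (Y j))) : p z := by
  have hz : z = ∑ j, inc (fun j => tensor (X j) (Y j)) j
      ((oplusEquiv fun j => tensor (X j) (Y j)) z j) := by
    apply (oplusEquiv fun j => tensor (X j) (Y j)).injective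
    rw [map_sum]
    ext i
    simp [inc]
  rw [hz]
  refine Finset.sum_induction _ p hadd h0 fun j _ => ?_
  generalize (oplusEquiv fun j => tensor (X j) (Y j)) z j = w
  refine TensorProduct.induction_on (motive := fun w : X j ⊗[ℂ] Y j =>
    p (inc (fun j => tensor (X j) (Y j)) j w)) w ?_ (fun x y => h j x y) ?_
  · have : inc (fun j => tensor (X j) (Y j)) j 0 = 0 := map_zero _
    exact this ▸ h0
  · intro x y hx hy
    have : inc (fun j => tensor (X j) (Y j)) j (x + y) = inc _ j x + inc _ j y := map_add _ _ _
    exact this ▸ hadd _ _ hx hy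

theorem oplus_ext {f g : oplus (fun j => tensor (X j) (Y j)) →ₗ[ℂ] M}
    (h : ∀ j (x : X j) (y : Y j), f (inc (fun j => tensor (X j) (Y j)) j (tmul x y)) =
      g (inc (fun j => tensor (X j) (Y j)) j (tmul x y))) : f = g := by
  ext z
  induction z using oplus_induction with
  | h0 => simp
  | hadd x y hx hy => rw [map_add, map_add, hx, hy]
  | h j x y => exact h j x y

theorem delta_eq {p : Prop} [Decidable p] (h : p) (u : delta p) : u = coord h u • one h := by
  apply (deltaEquiv p).injective
  ext ⟨i⟩
  simp [coord, one]

theorem delta_eq_zero {p : Prop} [Decidable p] (h : ¬ p) (u : delta p) : u = 0 := by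
  apply (deltaEquiv p).injective
  ext ⟨i⟩
  exact absurd i h

end FdHilb

/-- An object of the 2-category of finite-dimensional 2-Hilbert spaces: the 2-Hilbert space
`Hilb ^ dim`, a classical data type with `dim` possible values. -/
structure TwoHilb where
  dim : ℕ

namespace TwoHilb

open FdHilb

/-- A 1-cell `A ⟶ B`: a matrix of finite-dimensional Hilbert spaces, indexed by the values of the
source `A` and of the target `B`. Composition `F ≫ G` is juxtaposition from left to right. -/
structure Cell (A B : TwoHilb) where
  sp : Fin A.dim → Fin B.dim → FdHilb

/-- A 2-cell: a matrix of linear maps. -/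
@[ext] structure Cell2 {A B : TwoHilb} (F G : Cell A B) where
  app : ∀ i j, F.sp i j →ₗ[ℂ] G.sp i j

/-- Composition of 1-cells is matrix multiplication with `⊗` and `⊕`, the identity is the matrix
with `ℂ` on the diagonal and `0` elsewhere. -/
noncomputable instance : CategoryStruct TwoHilb where
  Hom := Cell
  id _ := ⟨fun i j => delta (i = j)⟩
  comp F G := ⟨fun i k => oplus fun j => tensor (F.sp i j) (G.sp j k)⟩

/-- Vertical composition of 2-cells is entrywise composition of linear maps. -/
instance (A B : TwoHilb) : Category (A ⟶ B) where
  Hom F G := Cell2 F G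
  id F := ⟨fun _ _ => LinearMap.id⟩
  comp s t := ⟨fun i j => t.app i j ∘ₗ s.app i j⟩

variable {A B C D E : TwoHilb}

@[ext] theorem hom_ext {F G : A ⟶ B} {s t : F ⟶ G} (h : ∀ i j, s.app i j = t.app i j) : s = t :=
  Cell2.ext (funext fun i => funext fun j => h i j)

@[simp] theorem id_app (F : A ⟶ B) (i : Fin A.dim) (j : Fin B.dim) :
    Cell2.app (𝟙 F) i j = LinearMap.id := rfl

@[simp] theorem comp_app {F G H : A ⟶ B} (s : F ⟶ G) (t : G ⟶ H) (i : Fin A.dim)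
    (j : Fin B.dim) : (s ≫ t).app i j = t.app i j ∘ₗ s.app i j := rfl

/-- The pure tensor `x ⊗ y` in the `j`-th summand of the `(i, k)` entry of a composite 1-cell. -/
noncomputable def el (F : A ⟶ B) (G : B ⟶ C) {i : Fin A.dim} {k : Fin C.dim} (j : Fin B.dim)
    (x : F.sp i j) (y : G.sp j k) : (F ≫ G).sp i k :=
  inc (fun j => tensor (F.sp i j) (G.sp j k)) j (tmul x y)

/-- `el` as a bilinear map. -/
noncomputable def elL (F : A ⟶ B) (G : B ⟶ C) (i : Fin A.dim) (k : Fin C.dim) (j : Fin B.dim) :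
    F.sp i j →ₗ[ℂ] G.sp j k →ₗ[ℂ] (F ≫ G).sp i k :=
  tcurry (inc (fun j => tensor (F.sp i j) (G.sp j k)) j)

@[simp] theorem elL_apply (F : A ⟶ B) (G : B ⟶ C) (i : Fin A.dim) (k : Fin C.dim)
    (j : Fin B.dim) (x : F.sp i j) (y : G.sp j k) : elL F G i k j x y = el F G j x y := rfl

/-- The linear map out of an entry of a composite 1-cell with given values on pure tensors. -/
noncomputable def elim (F : A ⟶ B) (G : B ⟶ C) {i : Fin A.dim} {k : Fin C.dim}
    {M : Type} [AddCommGroup M] [Module ℂ M] (f : ∀ j, F.sp i j →ₗ[ℂ] G.sp j k →ₗ[ℂ] M) :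
    (F ≫ G).sp i k →ₗ[ℂ] M :=
  desc fun j => tlift (f j)

section
variable {F : A ⟶ B} {G : B ⟶ C} {i : Fin A.dim} {k : Fin C.dim}
  {M : Type} [AddCommGroup M] [Module ℂ M]

@[simp] theorem elim_el (f : ∀ j, F.sp i j →ₗ[ℂ] G.sp j k →ₗ[ℂ] M) (j : Fin B.dim)
    (x : F.sp i j) (y : G.sp j k) : elim F G f (el F G j x y) = f j x y :=
  (desc_inc _ j _).trans (tlift_tmul _ x y)

theorem comp_induction {p : (F ≫ G).sp i k → Prop} (h0 : p 0)
    (hadd : ∀ x y, p x → p y → p (x + y)) (h : ∀ j x y, p (el F G j x y)) (z) : p z :=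
  oplus_induction h0 hadd h z

theorem comp_ext {f g : (F ≫ G).sp i k →ₗ[ℂ] M}
    (h : ∀ j x y, f (el F G j x y) = g (el F G j x y)) : f = g := oplus_ext h

end

theorem triple_ext {F : A ⟶ B} {G : B ⟶ C} {H : C ⟶ D} {i : Fin A.dim} {l : Fin D.dim}
    {M : Type} [AddCommGroup M] [Module ℂ M] {f g : ((F ≫ G) ≫ H).sp i l →ₗ[ℂ] M}
    (h : ∀ k j x y z, f (el (F ≫ G) H k (el F G j x y) z) =
      g (el (F ≫ G) H k (el F G j x y) z)) : f = g := by
  refine comp_ext fun k w z => ?_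
  have := comp_ext (f := f ∘ₗ (elL (F ≫ G) H i l k).flip z)
    (g := g ∘ₗ (elL (F ≫ G) H i l k).flip z) fun j x y => h k j x y z
  exact LinearMap.congr_fun this w

theorem triple_ext' {F : A ⟶ B} {G : B ⟶ C} {H : C ⟶ D} {i : Fin A.dim} {l : Fin D.dim}
    {M : Type} [AddCommGroup M] [Module ℂ M] {f g : (F ≫ G ≫ H).sp i l →ₗ[ℂ] M}
    (h : ∀ j k x y z, f (el F (G ≫ H) j x (el G H k y z)) =
      g (el F (G ≫ H) j x (el G H k y z))) : f = g := by
  refine comp_ext fun j x w => ?_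
  have := comp_ext (f := f ∘ₗ elL F (G ≫ H) i l j x)
    (g := g ∘ₗ elL F (G ≫ H) i l j x) fun k y z => h j k x y z
  exact LinearMap.congr_fun this w

theorem quad_ext {F : A ⟶ B} {G : B ⟶ C} {H : C ⟶ D} {K : D ⟶ E} {i : Fin A.dim}
    {m : Fin E.dim} {M : Type} [AddCommGroup M] [Module ℂ M]
    {f g : (((F ≫ G) ≫ H) ≫ K).sp i m →ₗ[ℂ] M}
    (h : ∀ l k j x y z w, f (el ((F ≫ G) ≫ H) K l (el (F ≫ G) H k (el F G j x y) z) w) =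
      g (el ((F ≫ G) ≫ H) K l (el (F ≫ G) H k (el F G j x y) z) w)) : f = g := by
  refine comp_ext fun l v w => ?_
  have := triple_ext (f := f ∘ₗ (elL ((F ≫ G) ≫ H) K i m l).flip w)
    (g := g ∘ₗ (elL ((F ≫ G) ≫ H) K i m l).flip w) fun k j x y z => h l k j x y z w
  exact LinearMap.congr_fun this v

/-- Left whiskering: `x ⊗ y ↦ x ⊗ s y`. -/
noncomputable def wl (F : A ⟶ B) {G H : B ⟶ C} (s : G ⟶ H) : F ≫ G ⟶ F ≫ H :=
  Cell2.mk fun i k => elim F G fun j => (elL F H i k j).compl₂ (s.app j k)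

/-- Right whiskering: `x ⊗ y ↦ s x ⊗ y`. -/
noncomputable def wr {F G : A ⟶ B} (s : F ⟶ G) (H : B ⟶ C) : F ≫ H ⟶ G ≫ H :=
  Cell2.mk fun i k => elim F H fun j => elL G H i k j ∘ₗ s.app i j

/-- `(x ⊗ y) ⊗ z ↦ x ⊗ (y ⊗ z)`. -/
noncomputable def assocHom (F : A ⟶ B) (G : B ⟶ C) (H : C ⟶ D) :
    (F ≫ G) ≫ H ⟶ F ≫ G ≫ H :=
  Cell2.mk fun i l => elim (F ≫ G) H fun k => elim F G fun j =>
    LinearMap.mk₂ ℂ (fun x y => elL F (G ≫ H) i l j x ∘ₗ elL G H j l k y)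
      (fun _ _ _ => by simp only [map_add, LinearMap.add_comp])
      (fun _ _ _ => by simp only [map_smul, LinearMap.smul_comp])
      (fun _ _ _ => by simp only [map_add, LinearMap.comp_add])
      (fun _ _ _ => by simp only [map_smul, LinearMap.comp_smul])

/-- `x ⊗ (y ⊗ z) ↦ (x ⊗ y) ⊗ z`. -/
noncomputable def assocInv (F : A ⟶ B) (G : B ⟶ C) (H : C ⟶ D) :
    F ≫ G ≫ H ⟶ (F ≫ G) ≫ H :=
  Cell2.mk fun i l => elim F (G ≫ H) fun j => LinearMap.flip <| elim G H fun k =>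
    LinearMap.mk₂ ℂ (fun y z => (elL (F ≫ G) H i l k).flip z ∘ₗ (elL F G i k j).flip y)
      (fun _ _ _ => by simp only [map_add, LinearMap.comp_add])
      (fun _ _ _ => by simp only [map_smul, LinearMap.comp_smul])
      (fun _ _ _ => by simp only [map_add, LinearMap.add_comp])
      (fun _ _ _ => by simp only [map_smul, LinearMap.smul_comp])

/-- `u ⊗ x ↦ u • x` on the summand where `u` is a scalar. -/
noncomputable def lunitHom (F : A ⟶ B) : 𝟙 A ≫ F ⟶ F :=
  Cell2.mk fun i k => elim (𝟙 A) F fun j =>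
    if h : i = j then
      LinearMap.mk₂ ℂ (fun u x => coord h u • (h ▸ LinearMap.id : F.sp j k →ₗ[ℂ] F.sp i k) x)
        (fun _ _ _ => by simp only [map_add, add_smul])
        (fun _ _ _ => by rw [map_smul, smul_assoc])
        (fun _ _ _ => by simp only [map_add, smul_add])
        (fun _ _ _ => by rw [map_smul, smul_comm])
    else 0

/-- `x ↦ 1 ⊗ x`. -/
noncomputable def lunitInv (F : A ⟶ B) : F ⟶ 𝟙 A ≫ F :=
  Cell2.mk fun i k => elL (𝟙 A) F i k i (one rfl)

/-- `x ⊗ u ↦ u • x` on the summand where `u` is a scalar. -/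
noncomputable def runitHom (F : A ⟶ B) : F ≫ 𝟙 B ⟶ F :=
  Cell2.mk fun i k => elim F (𝟙 B) fun j =>
    if h : j = k then
      LinearMap.mk₂ ℂ (fun x u => coord h u • (h ▸ LinearMap.id : F.sp i j →ₗ[ℂ] F.sp i k) x)
        (fun _ _ _ => by simp only [map_add, smul_add])
        (fun _ _ _ => by rw [map_smul, smul_comm])
        (fun _ _ _ => by simp only [map_add, add_smul])
        (fun _ _ _ => by rw [map_smul, smul_assoc])
    else 0

/-- `x ↦ x ⊗ 1`. -/
noncomputable def runitInv (F : A ⟶ B) : F ⟶ F ≫ 𝟙 B :=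
  Cell2.mk fun i k => (elL F (𝟙 B) i k k).flip (one rfl)

section
variable {i : Fin A.dim} {l : Fin D.dim} {k : Fin C.dim} {m : Fin B.dim}

@[simp] theorem wl_el (F : A ⟶ B) {G H : B ⟶ C} (s : G ⟶ H) (j : Fin B.dim) (x : F.sp i j)
    (y : G.sp j k) : (wl F s).app i k (el F G j x y) = el F H j x (s.app j k y) := by
  simp [wl]

@[simp] theorem wr_el {F G : A ⟶ B} (s : F ⟶ G) (H : B ⟶ C) (j : Fin B.dim) (x : F.sp i j)
    (y : H.sp j k) : (wr s H).app i k (el F H j x y) = el G H j (s.app i j x) y := by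
  simp [wr]

@[simp] theorem assocHom_el (F : A ⟶ B) (G : B ⟶ C) (H : C ⟶ D) (j : Fin B.dim) (k : Fin C.dim)
    (x : F.sp i j) (y : G.sp j k) (z : H.sp k l) :
    (assocHom F G H).app i l (el (F ≫ G) H k (el F G j x y) z) =
      el F (G ≫ H) j x (el G H k y z) := by
  simp [assocHom]

@[simp] theorem assocInv_el (F : A ⟶ B) (G : B ⟶ C) (H : C ⟶ D) (j : Fin B.dim) (k : Fin C.dim)
    (x : F.sp i j) (y : G.sp j k) (z : H.sp k l) :
    (assocInv F G H).app i l (el F (G ≫ H) j x (el G H k y z)) =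
      el (F ≫ G) H k (el F G j x y) z := by
  simp [assocInv]

@[simp] theorem lunitHom_el (F : A ⟶ B) (x : F.sp i m) :
    (lunitHom F).app i m (el (𝟙 A) F i (one rfl) x) = x := by
  simp [lunitHom]

@[simp] theorem lunitInv_apply (F : A ⟶ B) (x : F.sp i m) :
    (lunitInv F).app i m x = el (𝟙 A) F i (one rfl) x := rfl

@[simp] theorem runitHom_el (F : A ⟶ B) (x : F.sp i m) :
    (runitHom F).app i m (el F (𝟙 B) m x (one rfl)) = x := by
  simp [runitHom]

@[simp] theorem runitInv_apply (F : A ⟶ B) (x : F.sp i m) :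
    (runitInv F).app i m x = el F (𝟙 B) m x (one rfl) := rfl

theorem el_lunit (F : A ⟶ B) (j : Fin A.dim) (u : Cell.sp (𝟙 A) i j) (x : F.sp j m) :
    ∃ x', el (𝟙 A) F j u x = el (𝟙 A) F i (one rfl) x' := by
  by_cases h : i = j
  · subst h
    exact ⟨coord rfl u • x, by
      rw [← elL_apply, ← elL_apply, map_smul]
      conv_lhs => rw [delta_eq rfl u, map_smul, LinearMap.smul_apply]⟩
  · exact ⟨0, by rw [← elL_apply, ← elL_apply, delta_eq_zero h u, map_zero, map_zero]; rfl⟩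

theorem el_runit (F : A ⟶ B) (j : Fin B.dim) (x : F.sp i j) (u : Cell.sp (𝟙 B) j m) :
    ∃ x', el F (𝟙 B) j x u = el F (𝟙 B) m x' (one rfl) := by
  by_cases h : j = m
  · subst h
    exact ⟨coord rfl u • x, by
      rw [← elL_apply, ← elL_apply, map_smul, LinearMap.smul_apply]
      conv_lhs => rw [delta_eq rfl u, map_smul]⟩
  · exact ⟨0, by rw [← elL_apply, ← elL_apply, delta_eq_zero h u, map_zero, map_zero]; rfl⟩

theorem lunit_ext {F : A ⟶ B} {M : Type} [AddCommGroup M] [Module ℂ M]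
    {f g : (𝟙 A ≫ F).sp i m →ₗ[ℂ] M}
    (h : ∀ x, f (el (𝟙 A) F i (one rfl) x) = g (el (𝟙 A) F i (one rfl) x)) : f = g :=
  comp_ext fun j u x => by
    obtain ⟨x', hx⟩ := el_lunit F j u x
    rw [hx, h]

theorem runit_ext {F : A ⟶ B} {M : Type} [AddCommGroup M] [Module ℂ M]
    {f g : (F ≫ 𝟙 B).sp i m →ₗ[ℂ] M}
    (h : ∀ x, f (el F (𝟙 B) m x (one rfl)) = g (el F (𝟙 B) m x (one rfl))) : f = g :=
  comp_ext fun j x u => by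
    obtain ⟨x', hx⟩ := el_runit F j x u
    rw [hx, h]

theorem triangle_ext {F : A ⟶ B} {G : B ⟶ C} {M : Type} [AddCommGroup M] [Module ℂ M]
    {f g : ((F ≫ 𝟙 B) ≫ G).sp i k →ₗ[ℂ] M}
    (h : ∀ j x y, f (el (F ≫ 𝟙 B) G j (el F (𝟙 B) j x (one rfl)) y) =
      g (el (F ≫ 𝟙 B) G j (el F (𝟙 B) j x (one rfl)) y)) : f = g :=
  triple_ext fun j j' x u y => by
    obtain ⟨x', hx⟩ := el_runit F j' x u
    rw [hx, h]

end

/-- The 2-category of finite-dimensional 2-Hilbert spaces. -/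
noncomputable instance : Bicategory TwoHilb where
  whiskerLeft := wl
  whiskerRight := wr
  associator F G H :=
    ⟨assocHom F G H, assocInv F G H, by
      refine hom_ext fun _ _ => ?_; apply triple_ext; intros; simp,
      by
      refine hom_ext fun _ _ => ?_; apply triple_ext'; intros; simp⟩
  leftUnitor F :=
    ⟨lunitHom F, lunitInv F, by
      refine hom_ext fun _ _ => ?_; apply lunit_ext; intros; simp,
      by
      refine hom_ext fun _ _ => ?_; apply LinearMap.ext; intros; simp⟩
  rightUnitor F :=
    ⟨runitHom F, runitInv F, by
      refine hom_ext fun _ _ => ?_; apply runit_ext; intros; simp,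
      by
      refine hom_ext fun _ _ => ?_; apply LinearMap.ext; intros; simp⟩
  whiskerLeft_id := by
    intros; refine hom_ext fun _ _ => ?_; apply comp_ext; intros; simp
  whiskerLeft_comp := by
    intros; refine hom_ext fun _ _ => ?_; apply comp_ext; intros; simp
  id_whiskerLeft := by
    intros; refine hom_ext fun _ _ => ?_; apply lunit_ext; intros; simp
  comp_whiskerLeft := by
    intros; refine hom_ext fun _ _ => ?_; apply triple_ext; intros; simp
  id_whiskerRight := by
    intros; refine hom_ext fun _ _ => ?_; apply comp_ext; intros; simp
  comp_whiskerRight := by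
    intros; refine hom_ext fun _ _ => ?_; apply comp_ext; intros; simp
  whiskerRight_id := by
    intros; refine hom_ext fun _ _ => ?_; apply runit_ext; intros; simp
  whiskerRight_comp _ _ _ := by
      refine hom_ext fun _ _ => ?_; apply triple_ext'; intros; simp
  whisker_assoc := by
    intros; refine hom_ext fun _ _ => ?_; apply triple_ext; intros; simp
  whisker_exchange := by
    intros; refine hom_ext fun _ _ => ?_; apply comp_ext; intros; simp
  pentagon := by
    intros; refine hom_ext fun _ _ => ?_; apply quad_ext; intros; simp
  triangle := by
    intros; refine hom_ext fun _ _ => ?_; apply triangle_ext; intros; simp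

end TwoHilb

/-- A 2-cell `f` from `H ≫ J` to `F ≫ G` is horizontally invertible if, for some adjoints of its
four boundary 1-cells, there is a 2-cell `f'` of the mirrored type such that placing `f'` to the
right of `f`, or to the left of it, and joining the two neighbouring pairs of 1-cells by a cup and
a cap, gives a cap followed by a cup. (`f ⊣ g` has unit `𝟙 ⟶ f ≫ g` and counit `g ≫ f ⟶ 𝟙`, where
`≫` is horizontal juxtaposition from left to right.) -/
def HorizontallyInvertible {B : Type*} [Bicategory B] {a r g b : B} {H : a ⟶ r} {J : r ⟶ b}
    {F : a ⟶ g} {G : g ⟶ b} (f : H ≫ J ⟶ F ≫ G) : Prop :=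
  ∃ (F' : g ⟶ a) (J' : b ⟶ r) (G' : b ⟶ g) (H' : r ⟶ a)
    (adjF : Bicategory.Adjunction F F') (adjJ : Bicategory.Adjunction J J')
    (adjG : Bicategory.Adjunction G' G) (adjH : Bicategory.Adjunction H' H)
    (f' : J' ≫ H' ⟶ G' ≫ F'),
    𝟙 (H ≫ H') ⊗≫ H ◁ adjJ.unit ▷ H' ⊗≫ (f ▷ (J' ≫ H') ≫ (F ≫ G) ◁ f') ⊗≫
        F ◁ adjG.counit ▷ F' ⊗≫ 𝟙 (F ≫ F') = adjH.counit ≫ adjF.unit ∧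
    𝟙 (J' ≫ J) ⊗≫ J' ◁ adjH.unit ▷ J ⊗≫ (f' ▷ (H ≫ J) ≫ (G' ≫ F') ◁ f) ⊗≫
        G' ◁ adjF.counit ▷ G ⊗≫ 𝟙 (G' ≫ G) = adjJ.counit ≫ adjG.unit

namespace TwoHilb

open FdHilb

variable {A B : TwoHilb}

/-- The trivial classical data type `Hilb`. A 1-cell `unit ⟶ unit` is a single finite-dimensional
Hilbert space, that is, a quantum system uncorrelated with classical data. -/
abbrev unit : TwoHilb := ⟨1⟩

/-- The reversal of a 2-cell: the entrywise adjoint. -/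
noncomputable def dagger {F G : A ⟶ B} (s : F ⟶ G) : G ⟶ F :=
  Cell2.mk fun i j => LinearMap.adjoint (s.app i j)

/-- Unitary 2-cells. -/
def IsUnitary {F G : A ⟶ B} (s : F ⟶ G) : Prop :=
  s ≫ dagger s = 𝟙 F ∧ dagger s ≫ s = 𝟙 G

/-- Entrywise multiplication of a 2-cell by a scalar. -/
noncomputable instance (F G : A ⟶ B) : SMul ℂ (F ⟶ G) :=
  ⟨fun c s => Cell2.mk fun i j => c • s.app i j⟩

/-- Transport between equal entries of a 1-cell. -/
def entryCast (F : A ⟶ B) {i i' : Fin A.dim} {j j' : Fin B.dim} (hi : i = i') (hj : j = j') :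
    F.sp i j →ₗ[ℂ] F.sp i' j' :=
  hi ▸ hj ▸ LinearMap.id

/-- The symmetry `x ⊗ y ↦ y ⊗ x` of two Hilbert spaces, regarded as 1-cells `unit ⟶ unit`. -/
noncomputable def swap (X Y : unit ⟶ unit) : X ≫ Y ⟶ Y ≫ X :=
  Cell2.mk fun i k => elim X Y fun j =>
    ((elL Y X i k j).compl₁₂
      (entryCast Y (Subsingleton.elim (α := Fin 1) j i) (Subsingleton.elim (α := Fin 1) k j))
      (entryCast X (Subsingleton.elim (α := Fin 1) i j)
        (Subsingleton.elim (α := Fin 1) j k))).flip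

/-- Witnesses for the classical data type `A`: 1-cells from and to the trivial data type, with
2-cells creating, deleting, copying and comparing classical data (deletion and comparison being the
reversals of creation and copying), which satisfy the topological axioms. -/
structure Witness (A : TwoHilb) where
  left : unit ⟶ A
  right : A ⟶ unit
  create : 𝟙 unit ⟶ left ≫ right
  delete : left ≫ right ⟶ 𝟙 unit
  copy : 𝟙 A ⟶ right ≫ left
  compare : right ≫ left ⟶ 𝟙 A
  delete_eq : delete = dagger create
  compare_eq : compare = dagger copy
  create_compare_left :
    create ▷ left ≫ (α_ left right left).hom ≫ left ◁ compare = (λ_ left).hom ≫ (ρ_ left).inv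
  create_compare_right :
    right ◁ create ≫ (α_ right left right).inv ≫ compare ▷ right =
      (ρ_ right).hom ≫ (λ_ right).inv
  copy_delete_left :
    left ◁ copy ≫ (α_ left right left).inv ≫ delete ▷ left = (ρ_ left).hom ≫ (λ_ left).inv
  copy_delete_right :
    copy ▷ right ≫ (α_ right left right).hom ≫ right ◁ delete =
      (λ_ right).hom ≫ (ρ_ right).inv
  copy_compare : copy ≫ compare = 𝟙 (𝟙 A)
  comm :
    swap (left ≫ right) (left ≫ right) ≫
        (𝟙 ((left ≫ right) ≫ left ≫ right) ⊗≫ left ◁ compare ▷ right ⊗≫ 𝟙 (left ≫ right)) =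
      𝟙 ((left ≫ right) ≫ left ≫ right) ⊗≫ left ◁ compare ▷ right ⊗≫ 𝟙 (left ≫ right)

/-- A bipartite measurement vertex: a nondegenerate measurement of the joint system `Q ≫ Q`
(that is, `Q ⊗ Q`) with outcome in the classical data type `A`. -/
def IsBipartiteMeasurement {A : TwoHilb} (W : Witness A) {Q : unit ⟶ unit}
    (M : Q ≫ Q ⟶ W.left ≫ W.right) : Prop :=
  IsUnitary M

/-- The teleportation specification with measurement `M`, shared resource `ψ` and controlled
operation `U`: preparing `ψ` next to the input system, measuring the input and the first half of
`ψ`, and applying `U` to the second half, transfers the input system unchanged and leaves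
uniform classical data, up to the scalar `c`. -/
def Teleports {A : TwoHilb} (W : Witness A) {Q : unit ⟶ unit}
    (M : Q ≫ Q ⟶ W.left ≫ W.right) (ψ : 𝟙 unit ⟶ Q ≫ Q) (U : W.right ≫ Q ⟶ W.right ≫ Q)
    (c : ℂ) : Prop :=
  (ρ_ Q).inv ≫ Q ◁ ψ ≫ (α_ Q Q Q).inv ≫ M ▷ Q ≫ (α_ W.left W.right Q).hom ≫ W.left ◁ U =
    c • ((λ_ Q).inv ≫ W.create ▷ Q ≫ (α_ W.left W.right Q).hom)

/-- `M` forms part of a solution of the teleportation specification with general shared resource.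
As for every controlled operation, nothing is required of `U` beyond its type; in particular `U` may
be unitary. The nonzero scalar allows for any normalisation of `ψ` and of the uniform data. -/
def PartOfTeleportation {A : TwoHilb} (W : Witness A) {Q : unit ⟶ unit}
    (M : Q ≫ Q ⟶ W.left ≫ W.right) : Prop :=
  ∃ (ψ : 𝟙 unit ⟶ Q ≫ Q) (U : W.right ≫ Q ⟶ W.right ≫ Q) (c : ℂ), c ≠ 0 ∧ Teleports W M ψ U c

end TwoHilb

/-! ### Mates, horizontal inverses and protocols in an arbitrary bicategory. -/

namespace CategoryTheory.Bicategory

variable {B : Type*} [Bicategory B] {a r g b : B} {H : a ⟶ r} {J : r ⟶ b} {F : a ⟶ g}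
  {G : g ⟶ b} {F' : g ⟶ a} {J' : b ⟶ r} {G' : b ⟶ g} {H' : r ⟶ a}

/-! The contrapositive is proved: a solution of the specification yields a horizontal inverse of
`M`. Write `L ⊣ R` for the adjunction given by create and compare, and fix a self-duality `Q ⊣ Q`.
Both sides of the specification are 2-cells `Q ⇒ LRQ`, and bending `L` around turns them into
2-cells `RQ ⇒ RQ`. The right side becomes `c` times the identity, because create is the unit of `L ⊣
R`. The left side becomes the mate `RQ ⇒ RQ` of `M`, followed by the transpose of `ψ` and by `U`
(`homEquiv₁_protocol`). So the mate has a one-sided inverse up to the factor `c ≠ 0`.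

The mate is an endomorphism of a 1-cell with finite-dimensional entries, hence invertible
(`exists_inverse_of_comp_eq_smul`). Bending the inverse back along the same two adjunctions gives
the horizontal inverse: each of the two identities between the mate and its inverse unfolds to one
of the two pasting equations (`mateEquiv_symm_paste`). -/

/-- If the mates of two squares compose to the identity, then pasting the squares along a cup and
a cap gives a cap followed by a cup. -/
theorem mateEquiv_symm_paste (adjF : F ⊣ F') (adjJ : J ⊣ J') (adjG : G' ⊣ G) (adjH : H' ⊣ H)
    {θ : F' ≫ H ⟶ G ≫ J'} {θ' : G ≫ J' ⟶ F' ≫ H} (h : θ ≫ θ' = 𝟙 _) :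
    𝟙 (H ≫ H') ⊗≫ H ◁ adjJ.unit ▷ H' ⊗≫
      ((mateEquiv adjF adjJ).symm θ ▷ (J' ≫ H') ≫
        (F ≫ G) ◁ (mateEquiv adjG adjH).symm θ') ⊗≫
        F ◁ adjG.counit ▷ F' ⊗≫ 𝟙 (F ≫ F') = adjH.counit ≫ adjF.unit := by
  -- Sliding rule for the cup: `f` with the cup of `J` on its right equals `θ` with the cup of `F`
  -- on its left.
  have hf := (mateEquiv_eq_iff adjF adjJ _ θ).1 (Equiv.apply_symm_apply _ θ)
  have hf' := Equiv.apply_symm_apply (mateEquiv adjG adjH) θ'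
  generalize (mateEquiv adjF adjJ).symm θ = f at hf ⊢
  generalize (mateEquiv adjG adjH).symm θ' = f' at hf' ⊢
  -- Dual rule for the cap: `f'` with the cap of `G` on its left equals `θ'` with the cap of `H` on
  -- its right.
  have hf'' : adjG.homEquiv₁ f' = (α_ _ _ _).inv ≫ adjH.homEquiv₂.symm θ' := by
    rw [Iso.eq_inv_comp, Equiv.eq_symm_apply, ← hf', mateEquiv_apply']
    simp only [Adjunction.homEquiv₁_apply, Adjunction.homEquiv₂_apply]
    bicategory
  rw [Adjunction.homEquiv₁_symm_apply, Adjunction.homEquiv₂_apply] at hf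
  rw [Adjunction.homEquiv₁_apply, Adjunction.homEquiv₂_symm_apply] at hf''
  calc
    _ = 𝟙 _ ⊗≫ ((ρ_ H).inv ≫ H ◁ adjJ.unit ≫ (α_ _ _ _).inv ≫ f ▷ J' ≫ (α_ _ _ _).hom) ▷ H' ⊗≫
          F ◁ (G ◁ f' ≫ (α_ _ _ _).inv ≫ adjG.counit ▷ F' ≫ (λ_ _).hom) := by
      bicategory
    _ = 𝟙 _ ⊗≫ adjF.unit ▷ H ▷ H' ⊗≫ F ◁ (θ ≫ θ') ▷ H' ⊗≫ F ◁ F' ◁ adjH.counit ⊗≫ 𝟙 _ := by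
      simp only [Category.assoc] at hf
      rw [← hf, hf'']
      bicategory
    _ = 𝟙 _ ⊗≫ (adjF.unit ▷ (H ≫ H') ≫ (F ≫ F') ◁ adjH.counit) ⊗≫ 𝟙 _ := by
      rw [h]; bicategory
    -- With `θ ≫ θ'` gone, the cup of `F` and the cap of `H` are side by side, so the interchange
    -- law puts the cap first.
    _ = _ := by
      rw [← whisker_exchange]; bicategory

/-- A 2-cell with an invertible mate is horizontally invertible. -/
theorem _root_.HorizontallyInvertible.of_mateEquiv (adjF : F ⊣ F') (adjJ : J ⊣ J')
    (adjG : G' ⊣ G) (adjH : H' ⊣ H) {f : H ≫ J ⟶ F ≫ G} {θ' : G ≫ J' ⟶ F' ≫ H}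
    (h : mateEquiv adjF adjJ f ≫ θ' = 𝟙 _) (h' : θ' ≫ mateEquiv adjF adjJ f = 𝟙 _) :
    HorizontallyInvertible f := by
  refine ⟨F', J', G', H', adjF, adjJ, adjG, adjH, (mateEquiv adjG adjH).symm θ', ?_, ?_⟩
  · simpa only [Equiv.symm_apply_apply] using mateEquiv_symm_paste adjF adjJ adjG adjH h
  -- The second pasting equation is the first for the mirrored square, with the pairs `F, J` and `G,
  -- H` of adjunctions exchanged.
  · simpa only [Equiv.symm_apply_apply] using mateEquiv_symm_paste adjG adjH adjF adjJ h'

/-- The mate of a measurement, followed by the transpose of a resource `ψ` and an operation `U`,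
is the transpose of the corresponding protocol. -/
theorem homEquiv₁_protocol {K : b ⟶ r} {Z : g ⟶ r} (adjF : F ⊣ F') (adjJ : J ⊣ J')
    (f : H ≫ J ⟶ F ≫ G) (ψ : 𝟙 r ⟶ J ≫ K) (U : G ≫ K ⟶ Z) :
    adjF.homEquiv₁ ((ρ_ H).inv ≫ H ◁ ψ ≫ (α_ H J K).inv ≫ f ▷ K ≫ (α_ F G K).hom ≫ F ◁ U) =
      mateEquiv adjF adjJ f ≫ G ◁ ((ρ_ J').inv ≫ adjJ.homEquiv₁ ψ) ≫ U := by
  -- Any resource is the cup of `J` followed by some `φ` on its second leg. The cup bends `f` into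
  -- its mate, and interchange moves `φ` and `U` after it.
  obtain ⟨φ, rfl⟩ := adjJ.homEquiv₁.symm.surjective ψ
  rw [Equiv.apply_symm_apply, mateEquiv_apply', Adjunction.homEquiv₁_apply,
    Adjunction.homEquiv₁_symm_apply]
  calc
    _ = 𝟙 _ ⊗≫ F' ◁ H ◁ adjJ.unit ⊗≫ F' ◁ ((H ≫ J) ◁ ((ρ_ J').inv ≫ φ) ≫ f ▷ K) ⊗≫
          ((F' ≫ F) ◁ U ≫ adjF.counit ▷ Z) ⊗≫ 𝟙 _ := by
      bicategory
    _ = 𝟙 _ ⊗≫ F' ◁ H ◁ adjJ.unit ⊗≫ F' ◁ f ▷ J' ⊗≫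
          ((F' ≫ F) ◁ G ◁ ((ρ_ J').inv ≫ φ) ≫ adjF.counit ▷ (G ≫ K)) ⊗≫ U := by
      rw [whisker_exchange, whisker_exchange]
      bicategory
    _ = _ := by
      rw [whisker_exchange]
      bicategory

end CategoryTheory.Bicategory

/-! ### Duals, linearity and finite-dimensional inverses in the 2-category of 2-Hilbert spaces. -/

namespace TwoHilb

open FdHilb

variable {A B C : TwoHilb}

/-- The transpose of a matrix of Hilbert spaces. -/
abbrev transpose (F : A ⟶ B) : B ⟶ A := Cell.mk fun j i => F.sp i j

/-- A basis of an entry of a 1-cell. -/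
noncomputable def entryBasis (F : A ⟶ B) (i : Fin A.dim) (j : Fin B.dim) :
    Module.Basis (Fin (Module.finrank ℂ (F.sp i j))) ℂ (F.sp i j) :=
  Module.finBasis ℂ (F.sp i j)

/-- The bilinear form for which the basis of an entry is orthonormal. -/
noncomputable def entryPairing (F : A ⟶ B) (i : Fin A.dim) (j : Fin B.dim) :
    F.sp i j →ₗ[ℂ] F.sp i j →ₗ[ℂ] ℂ :=
  ∑ p, ((entryBasis F i j).coord p).smulRight ((entryBasis F i j).coord p)

/-- Pairing with a basis vector reads off a coordinate, so the zig-zag equations below reduce to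
expansion in a basis. -/
theorem entryPairing_basis_left (F : A ⟶ B) (i : Fin A.dim) (j : Fin B.dim) (p) (x : F.sp i j) :
    entryPairing F i j (entryBasis F i j p) x = (entryBasis F i j).repr x p := by
  simp [entryPairing, Finsupp.single_apply]

theorem entryPairing_basis_right (F : A ⟶ B) (i : Fin A.dim) (j : Fin B.dim) (p) (x : F.sp i j) :
    entryPairing F i j x (entryBasis F i j p) = (entryBasis F i j).repr x p := by
  simp [entryPairing, Finsupp.single_apply]

/-- The cup of a 1-cell and its transpose. -/
noncomputable def cup (F : A ⟶ B) : 𝟙 A ⟶ F ≫ transpose F :=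
  Cell2.mk fun i k => if h : i = k then
      (coord h).smulRight (∑ j, ∑ p, el F (transpose F) j (entryBasis F i j p)
        (h ▸ entryBasis F i j p : F.sp k j))
    else 0

/-- The cap of a 1-cell and its transpose. -/
noncomputable def cap (F : A ⟶ B) : transpose F ≫ F ⟶ 𝟙 B :=
  Cell2.mk fun j l => elim (transpose F) F fun i =>
    if h : j = l then
      (h ▸ (entryPairing F i j).compr₂ (LinearMap.toSpanSingleton ℂ (delta (j = j)) (one rfl)) :
        F.sp i j →ₗ[ℂ] F.sp i l →ₗ[ℂ] delta (j = l))
    else 0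

theorem cup_app_one (F : A ⟶ B) (i : Fin A.dim) :
    (cup F).app i i (one rfl) =
      ∑ j, ∑ p, elL F (transpose F) i i j (entryBasis F i j p) (entryBasis F i j p) := by
  have : (cup F).app i i = (coord rfl).smulRight
      (∑ j, ∑ p, el F (transpose F) j (entryBasis F i j p) (entryBasis F i j p)) := dif_pos rfl
  rw [this, LinearMap.smulRight_apply, coord_one, one_smul]
  rfl

theorem cap_app_el (F : A ⟶ B) (i : Fin A.dim) (j : Fin B.dim) (x y : F.sp i j) :
    (cap F).app j j (el (transpose F) F i x y) =
      entryPairing F i j x y • (one rfl : delta (j = j)) := by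
  refine (elim_el _ i _ _).trans ?_
  exact LinearMap.congr_fun₂ (dif_pos rfl) x y

theorem cap_app_of_ne (F : A ⟶ B) {i : Fin A.dim} {j l : Fin B.dim} (h : j ≠ l)
    (x : F.sp i j) (y : F.sp i l) :
    (cap F).app j l (el (transpose F) F i x y) = 0 := by
  refine (elim_el _ i _ _).trans ?_
  exact LinearMap.congr_fun₂ (dif_neg h) x y

/-- The cap vanishes off the diagonal, so only one summand of the cup survives, and there the
composite expands `x` in the basis. The explicit `wr`, `assocHom` and `wl` allow evaluation on pure
tensors. -/
theorem cup_cap_left (F : A ⟶ B) :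
    wr (cup F) F ≫ assocHom F (transpose F) F ≫ wl F (cap F) = lunitHom F ≫ runitInv F := by
  refine hom_ext fun i l => lunit_ext fun x => ?_
  simp only [comp_app, LinearMap.comp_apply, wr_el, lunitHom_el, runitInv_apply, cup_app_one]
  rw [← elL_apply, map_sum, LinearMap.sum_apply, map_sum, map_sum,
    Finset.sum_eq_single_of_mem l (Finset.mem_univ l)]
  · rw [map_sum, LinearMap.sum_apply, map_sum, map_sum]
    conv_rhs => rw [← (entryBasis F i l).sum_repr x, ← elL_apply, map_sum, LinearMap.sum_apply]
    refine Finset.sum_congr rfl fun p _ => ?_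
    rw [elL_apply, elL_apply, assocHom_el, wl_el, cap_app_el, entryPairing_basis_left,
      ← elL_apply, map_smul, map_smul, LinearMap.smul_apply]
  · intro j _ hj
    rw [map_sum, LinearMap.sum_apply, map_sum, map_sum]
    refine Finset.sum_eq_zero fun p _ => ?_
    rw [elL_apply, elL_apply, assocHom_el, wl_el, cap_app_of_ne F hj, ← elL_apply, map_zero]

theorem cup_cap_right (F : A ⟶ B) :
    wl (transpose F) (cup F) ≫ assocInv (transpose F) F (transpose F) ≫
      wr (cap F) (transpose F) = runitHom (transpose F) ≫ lunitInv (transpose F) := by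
  refine hom_ext fun j i => runit_ext fun x => ?_
  simp only [comp_app, LinearMap.comp_apply, wl_el, runitHom_el, lunitInv_apply, cup_app_one]
  rw [← elL_apply, map_sum, map_sum, map_sum,
    Finset.sum_eq_single_of_mem j (Finset.mem_univ j)]
  · rw [map_sum, map_sum, map_sum]
    conv_rhs => rw [← (entryBasis F i j).sum_repr x, ← elL_apply, map_sum]
    refine Finset.sum_congr rfl fun p _ => ?_
    rw [elL_apply, elL_apply, assocInv_el, wr_el, cap_app_el, entryPairing_basis_right,
      ← elL_apply, map_smul, map_smul, LinearMap.smul_apply]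
  · intro l _ hl
    rw [map_sum, map_sum, map_sum]
    refine Finset.sum_eq_zero fun p _ => ?_
    rw [elL_apply, elL_apply, assocInv_el, wr_el, cap_app_of_ne F hl.symm, ← elL_apply, map_zero,
      LinearMap.zero_apply]

/-- The transpose of a 1-cell is right adjoint to it. -/
noncomputable def transposeAdj (F : A ⟶ B) : F ⊣ transpose F where
  unit := cup F
  counit := cap F
  left_triangle := by
    refine Eq.trans ?_ (cup_cap_left F)
    simp [bicategoricalComp]
    rfl
  right_triangle := by
    refine Eq.trans ?_ (cup_cap_right F)
    simp [bicategoricalComp]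
    rfl

/-- A Hilbert space, regarded as a 1-cell, is self-dual. -/
theorem nonempty_adjunction_self (Q : unit ⟶ unit) : Nonempty (Q ⊣ Q) := by
  have : transpose Q = Q := by
    refine congrArg Cell.mk (funext fun i => funext fun j => ?_)
    -- A one-by-one matrix equals its transpose. No conjugate space appears, since the pairing is
    -- bilinear rather than sesquilinear.
    rw [Subsingleton.elim (α := Fin 1) i j]
  exact ⟨cast (congrArg (Q ⊣ ·) this) (transposeAdj Q)⟩

/-- Creation and comparison of classical data exhibit the 1-cells of a witness as adjoint. -/
def Witness.adjunction (W : Witness A) : W.left ⊣ W.right where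
  unit := W.create
  counit := W.compare
  left_triangle := by
    rw [← W.create_compare_left]; simp [bicategoricalComp]
  right_triangle := by
    rw [← W.create_compare_right]; simp [bicategoricalComp]

theorem smul_app {F G : A ⟶ B} (c : ℂ) (s : F ⟶ G) (i : Fin A.dim) (j : Fin B.dim) :
    (c • s).app i j = c • s.app i j := rfl

/-- Whiskering and composition are linear in each entry; this carries the scalar `c` through the
transposition. -/
theorem homEquiv₁_smul {F : A ⟶ B} {F' : B ⟶ A} (adj : F ⊣ F') {X : A ⟶ C} {Y : B ⟶ C}
    (c : ℂ) (γ : X ⟶ F ≫ Y) : adj.homEquiv₁ (c • γ) = c • adj.homEquiv₁ γ := by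
  have e : F' ◁ (c • γ) = c • F' ◁ γ := by
    refine hom_ext fun i k => comp_ext fun j x y => ?_
    change (wl F' (c • γ)).app i k (el F' X j x y) =
      c • (wl F' γ).app i k (el F' X j x y)
    rw [wl_el, wl_el, smul_app, LinearMap.smul_apply, ← elL_apply, map_smul, elL_apply]
  rw [Adjunction.homEquiv₁_apply, Adjunction.homEquiv₁_apply, e]
  refine hom_ext fun i k => ?_
  simp only [comp_app, smul_app, LinearMap.comp_smul]

/-- A one-sided inverse of an endomorphism of a 1-cell, up to a nonzero scalar, can be rescaled to
a two-sided inverse. -/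
theorem exists_inverse_of_comp_eq_smul {F : A ⟶ B} {s t : F ⟶ F} {c : ℂ} (hc : c ≠ 0)
    (h : s ≫ t = c • 𝟙 F) : ∃ t' : F ⟶ F, s ≫ t' = 𝟙 F ∧ t' ≫ s = 𝟙 F := by
  have h₁ (i j) : (c⁻¹ • t.app i j) ∘ₗ s.app i j = LinearMap.id := by
    have := congrArg (fun u => c⁻¹ • Cell2.app u i j) h
    simpa [smul_app, LinearMap.smul_comp, smul_smul, hc] using this
  -- For endomorphisms of a finite-dimensional space a one-sided inverse is two-sided; this is
  -- applied to each entry.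
  exact ⟨c⁻¹ • t, hom_ext fun i j => h₁ i j,
    hom_ext fun i j => mul_eq_one_comm.1 (h₁ i j)⟩

end TwoHilb

/-! ### The theorem. -/

theorem mainTheorem6 {A : TwoHilb} (W : TwoHilb.Witness A) {Q : TwoHilb.unit ⟶ TwoHilb.unit}
    (M : Q ≫ Q ⟶ W.left ≫ W.right) (hM : TwoHilb.IsBipartiteMeasurement W M)
    (hinv : ¬ HorizontallyInvertible M) : ¬ TwoHilb.PartOfTeleportation W M := by
  rintro ⟨ψ, U, c, hc, h⟩
  obtain ⟨adjQ⟩ := TwoHilb.nonempty_adjunction_self Q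
  -- Create is the unit of `W.adjunction`, so uniform data next to an untouched `Q` is the transpose
  -- of the identity of `RQ`.
  have e : (λ_ Q).inv ≫ W.create ▷ Q ≫ (α_ W.left W.right Q).hom =
      W.adjunction.homEquiv₁.symm (𝟙 _) := by
    simp [Adjunction.homEquiv₁_symm_apply, TwoHilb.Witness.adjunction]
  have h' := congrArg W.adjunction.homEquiv₁ h
  rw [Bicategory.homEquiv₁_protocol W.adjunction adjQ, e, TwoHilb.homEquiv₁_smul,
    Equiv.apply_symm_apply] at h'
  -- By now `h'` says that the mate of `M`, followed by a 2-cell built from `ψ` and `U`, is `c • 𝟙`.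
  obtain ⟨t, h₁, h₂⟩ := TwoHilb.exists_inverse_of_comp_eq_smul hc h'
  -- Two adjunctions serve all four sides: `L ⊣ R` gives both the right adjoint of `L` and the left
  -- adjoint of `R`, and `Q ⊣ Q` does the same for the two copies of `Q`.
  exact hinv (.of_mateEquiv W.adjunction adjQ W.adjunction adjQ h₁ h₂)
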